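/- Let $n\geq 1$ be a fixed integer. For a positive integer $H$ let $G_n(H)$ be the number of distinct fields $\mathbb{Q}(\sqrt{a_1},\ldots,\sqrt{a_n})$ (regarded as subfields of $\mathbb{R}$), where $a_1,\ldots,a_n$ run over the integers in $[1,H]$, for which $$\operatorname{Gal}\bigl(\mathbb{Q}(\sqrt{a_1},\ldots,\sqrt{a_n})/\mathbb{Q}\bigr)\cong(\mathbb{Z}/2\mathbb{Z})^n .$$ Then, as $H\to\infty$ through the integers, $$G_n(H)=\left(\frac{1}{n!\,\zeta(2)^n}+O\!\left(\exp\!\left(-(1+o(1))\sqrt{\tfrac12(\log H)(\log\log H)}\right)\right)\right)H^n ,$$ where $\zeta$ is the Riemann zeta function, and the implied constant and the function $o(1)$ may depend on $n$. That is, there are a real function $\varepsilon(H)$ with $\varepsilon(H)\to 0$ as $H\to\infty$ and constants $C,H_0$, all of which may depend on $n$, such that for all integers $H\geq H_0$, $$\left|G_n(H)-\frac{H^n}{n!\,\zeta(2)^n}\right|\leq C\exp\!\left(-(1+\varepsilon(H))\sqrt{\tfrac12(\log H)(\log\log H)}\right)H^n .$$ -/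

import Mathlib

open Filter Topology Asymptotics
open scoped Nat

noncomputable section

/-- The multiquadratic field `ℚ(√a₁, …, √aₙ)`, as a subfield of `ℝ`. -/
def multiquadraticField {n : ℕ} (a : Fin n → ℕ) : IntermediateField ℚ ℝ :=
  IntermediateField.adjoin ℚ (Set.range fun i => √(a i : ℝ))

/-- The set of fields `ℚ(√a₁, …, √aₙ)` with integers `1 ≤ aᵢ ≤ H` whose Galois group over `ℚ`
is isomorphic to `(ℤ/2ℤ)ⁿ`. -/
def maxGaloisFields (n H : ℕ) : Set (IntermediateField ℚ ℝ) :=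
  {K | ∃ a : Fin n → ℕ, (∀ i, 1 ≤ a i ∧ a i ≤ H) ∧ multiquadraticField a = K ∧
    Nonempty (Gal(K/ℚ) ≃* Multiplicative (Fin n → ZMod 2))}

/-- There are finitely many such fields, so counting them with `Set.ncard` is meaningful. -/
theorem maxGaloisFields_finite (n H : ℕ) : (maxGaloisFields n H).Finite := by
  have hbox : (Set.univ.pi fun _ : Fin n => Set.Icc 1 H).Finite :=
    Set.Finite.pi fun _ => Set.finite_Icc 1 H
  refine (hbox.image multiquadraticField).subset ?_
  rintro K ⟨a, ha, hK, -⟩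
  exact ⟨a, fun i _ => ha i, hK⟩

/-- `G_n(H)`: the number of distinct fields `ℚ(√a₁, …, √aₙ)` with `a ∈ [1, H]ⁿ` integral and
Galois group `(ℤ/2ℤ)ⁿ`. -/
def maxGaloisCount (n H : ℕ) : ℕ := (maxGaloisFields n H).ncard

end

/-!
A field `ℚ(√a₁, …, √aₙ)` depends only on the squarefree parts of the `aᵢ`, so everything is counted
on the `Qⁿ` tuples of squarefree numbers in `[1, H]`, where `Q = H / ζ(2) + O(√H)`.

Call a tuple degenerate if some entry is `1`, or if the product of two or more entries is, modulo
squares, some number up to `H`. For a nondegenerate tuple `s` the `sᵢ` are independent modulo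
squares, so the Galois group is `(ℤ/2ℤ)ⁿ` (`nonempty_gal_mulEquiv`). By Kummer theory
(`exists_isSquare_mul_prod_of_sqrt_mem`) the only squarefree numbers in `(1, H]` with a square root
in the field of `s` are the `sᵢ` themselves, so the field determines `s` up to order, and exactly
`n!` nondegenerate tuples share each field. Thus the count of fields is `Qⁿ / n!` up to twice the
number of degenerate tuples (`abs_maxGaloisCount_sub_le`).

Degenerate tuples are rare. Suppose the product over `I`, `|I| ≥ 2`, has squarefree part at most `H`,
let `j ∈ I`, and let `w` be the squarefree part of the product over the rest of `I`. The number
`w` determines each further entry in terms of the others, so few tuples have `w ≤ √H`. If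
`w > √H`, then the entry `y = sⱼ` satisfies `w y / gcd(w, y)² ≤ H`, which leaves at most
`τ(w) H / √w` choices. With the divisor bound for `τ(w)` the degenerate tuples number
`O(H ^ (n - 1/8))` (`exists_card_degenerateTuples_le`).

For fixed `n` the error is therefore smaller than `Hⁿ` by a power of `H`, which is
stronger than the factor `exp(-(1 + o(1)) √(log H log log H / 2))`.
-/

/-! ### Galois theory of multiquadratic fields -/

/-- If `r² ∈ K`, every element of `K(r)` has the form `u + v r` with `u, v ∈ K`. -/
lemma exists_add_mul_of_mem_adjoin_insert {S : Set ℝ} {r : ℝ}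
    (hr : r ^ 2 ∈ IntermediateField.adjoin ℚ S) {x : ℝ}
    (hx : x ∈ IntermediateField.adjoin ℚ (insert r S)) :
    ∃ u ∈ IntermediateField.adjoin ℚ S, ∃ v ∈ IntermediateField.adjoin ℚ S, x = u + v * r := by
  set K := IntermediateField.adjoin ℚ S
  induction hx using IntermediateField.adjoin_induction with
  | mem x hx =>
    rcases hx with rfl | hx
    · exact ⟨0, K.zero_mem, 1, K.one_mem, by ring⟩
    · exact ⟨x, IntermediateField.subset_adjoin ℚ S hx, 0, K.zero_mem, by ring⟩
  | algebraMap q => exact ⟨algebraMap ℚ ℝ q, K.algebraMap_mem q, 0, K.zero_mem, by ring⟩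
  | add x y _ _ hx hy =>
    obtain ⟨u, hu, v, hv, rfl⟩ := hx
    obtain ⟨u', hu', v', hv', rfl⟩ := hy
    exact ⟨u + u', K.add_mem hu hu', v + v', K.add_mem hv hv', by ring⟩
  | inv x _ hx =>
    obtain ⟨u, hu, v, hv, rfl⟩ := hx
    by_cases h : u - v * r = 0
    · refine ⟨(u + u)⁻¹, K.inv_mem (K.add_mem hu hu), 0, K.zero_mem, ?_⟩
      rw [← sub_eq_zero.mp h]; ring
    · by_cases h' : u + v * r = 0
      · exact ⟨0, K.zero_mem, 0, K.zero_mem, by rw [h']; ring⟩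
      have hN : u ^ 2 - v ^ 2 * r ^ 2 ∈ K :=
        K.sub_mem (K.pow_mem hu 2) (K.mul_mem (K.pow_mem hv 2) hr)
      have hN0 : u ^ 2 - v ^ 2 * r ^ 2 ≠ 0 := by
        have := mul_ne_zero h h'
        contrapose! this
        linear_combination this
      refine ⟨u * (u ^ 2 - v ^ 2 * r ^ 2)⁻¹, K.mul_mem hu (K.inv_mem hN),
        -v * (u ^ 2 - v ^ 2 * r ^ 2)⁻¹, K.mul_mem (K.neg_mem hv) (K.inv_mem hN), ?_⟩
      field_simp
      ring
  | mul x y _ _ hx hy =>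
    obtain ⟨u, hu, v, hv, rfl⟩ := hx
    obtain ⟨u', hu', v', hv', rfl⟩ := hy
    exact ⟨u * u' + v * v' * r ^ 2,
      K.add_mem (K.mul_mem hu hu') (K.mul_mem (K.mul_mem hv hv') hr),
      u * v' + v * u', K.add_mem (K.mul_mem hu hv') (K.mul_mem hv hu'), by ring⟩

/-- Kummer theory for square roots: a square root lying in a multiquadratic field is, up to a
rational factor, a product of some of the generating square roots. -/
lemma exists_isSquare_mul_prod_of_sqrt_mem {ι : Type*} [DecidableEq ι] (a : ι → ℕ)
    (T : Finset ι) (d : ℕ)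
    (hd : √(d : ℝ) ∈ IntermediateField.adjoin ℚ ((fun i => √(a i : ℝ)) '' (T : Set ι))) :
    ∃ J ⊆ T, IsSquare (d * ∏ j ∈ J, a j) := by
  induction T using Finset.induction_on generalizing d with
  | empty =>
    refine ⟨∅, le_rfl, ?_⟩
    simp only [Finset.coe_empty, Set.image_empty, IntermediateField.adjoin_empty,
      IntermediateField.mem_bot] at hd
    obtain ⟨q, hq⟩ := hd
    have hq2 : (q : ℝ) * q = d := by
      have : (q : ℝ) = √(d : ℝ) := hq
      rw [this, Real.mul_self_sqrt (Nat.cast_nonneg d)]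
    have : IsSquare (d : ℚ) := ⟨q, by exact_mod_cast hq2.symm⟩
    simpa using Rat.isSquare_natCast_iff.mp this
  | insert i T hi ih =>
    rw [Finset.coe_insert, Set.image_insert_eq] at hd
    set S := (fun i => √(a i : ℝ)) '' (T : Set ι)
    set K := IntermediateField.adjoin ℚ S
    have hsq : √(a i : ℝ) ^ 2 = a i := Real.sq_sqrt (Nat.cast_nonneg _)
    have hr : √(a i : ℝ) ^ 2 ∈ K := by
      rw [hsq]; exact natCast_mem K _
    obtain ⟨u, hu, v, hv, hx⟩ := exists_add_mul_of_mem_adjoin_insert hr hd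
    have hdsq : √(d : ℝ) ^ 2 = d := Real.sq_sqrt (Nat.cast_nonneg _)
    by_cases hv0 : v = 0
    · obtain ⟨J, hJ, h⟩ := ih d (by rw [hx, hv0]; simpa using hu)
      exact ⟨J, hJ.trans (Finset.subset_insert i T), h⟩
    by_cases hu0 : u = 0
    · obtain ⟨J, hJ, h⟩ := ih (d * a i) (by
        push_cast
        rw [Real.sqrt_mul (Nat.cast_nonneg d), hx, hu0]
        have : (0 + v * √(a i : ℝ)) * √(a i : ℝ) = v * √(a i : ℝ) ^ 2 := by ring
        rw [this]
        exact K.mul_mem hv hr)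
      refine ⟨insert i J, Finset.insert_subset_insert i hJ, ?_⟩
      rwa [Finset.prod_insert fun h => hi (hJ h), ← mul_assoc]
    · -- the cross term `2uv√aᵢ = d - u² - v²aᵢ` forces `√aᵢ` into the smaller field
      have hmem : √(a i : ℝ) ∈ K := by
        have : √(a i : ℝ) = (d - u ^ 2 - v ^ 2 * √(a i : ℝ) ^ 2) * (2 * u * v)⁻¹ := by
          rw [← hdsq, hx]; field_simp; ring
        rw [this]
        exact K.mul_mem (K.sub_mem (K.sub_mem (natCast_mem K _) (K.pow_mem hu 2))
          (K.mul_mem (K.pow_mem hv 2) hr))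
          (K.inv_mem (K.mul_mem (K.mul_mem (ofNat_mem K 2) hu) hv))
      obtain ⟨J, hJ, h⟩ := ih d (by rw [hx]; exact K.add_mem hu (K.mul_mem hv hmem))
      exact ⟨J, hJ.trans (Finset.subset_insert i T), h⟩

lemma isIntegral_sqrt_natCast (a : ℕ) : IsIntegral ℚ √(a : ℝ) := by
  refine ⟨Polynomial.X ^ 2 - Polynomial.C (a : ℚ),
    Polynomial.monic_X_pow_sub_C _ two_ne_zero, ?_⟩
  simp [Real.sq_sqrt (Nat.cast_nonneg a)]

lemma finiteDimensional_adjoin_sqrt {ι : Type*} (a : ι → ℕ) {T : Set ι} (hT : T.Finite) :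
    FiniteDimensional ℚ (IntermediateField.adjoin ℚ ((fun i => √(a i : ℝ)) '' T)) := by
  have : Finite ((fun i => √(a i : ℝ)) '' T) := hT.image _
  refine IntermediateField.finiteDimensional_adjoin ?_
  rintro _ ⟨i, -, rfl⟩
  exact isIntegral_sqrt_natCast _

/-- Adjoining square roots that are independent modulo rational squares at least doubles the
degree each time. -/
lemma two_pow_card_le_finrank_adjoin_sqrt {ι : Type*} [DecidableEq ι] (a : ι → ℕ)
    (h : ∀ I : Finset ι, I.Nonempty → ¬ IsSquare (∏ i ∈ I, a i)) (T : Finset ι) :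
    2 ^ T.card ≤ Module.finrank ℚ
      (IntermediateField.adjoin ℚ ((fun i => √(a i : ℝ)) '' (T : Set ι))) := by
  induction T using Finset.induction_on with
  | empty =>
    rw [Finset.coe_empty, Set.image_empty, IntermediateField.adjoin_empty]
    simp
  | insert i T hi ih =>
    rw [Finset.card_insert_of_notMem hi, pow_succ]
    set E := IntermediateField.adjoin ℚ ((fun i => √(a i : ℝ)) '' ((insert i T : Finset ι) : Set ι))
    set F := IntermediateField.adjoin ℚ ((fun i => √(a i : ℝ)) '' (T : Set ι))
    have : FiniteDimensional ℚ E := finiteDimensional_adjoin_sqrt a (Finset.finite_toSet _)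
    have hFE : F ≤ E :=
      IntermediateField.adjoin.mono _ _ _ (Set.image_mono (by simp))
    have hE : √(a i : ℝ) ∈ E :=
      IntermediateField.subset_adjoin ℚ _ ⟨i, by simp, rfl⟩
    have hF : √(a i : ℝ) ∉ F := by
      intro hmem
      obtain ⟨J, hJ, hsq⟩ := exists_isSquare_mul_prod_of_sqrt_mem a T (a i) hmem
      refine h (insert i J) (Finset.insert_nonempty i J) ?_
      rwa [Finset.prod_insert fun h => hi (hJ h)]
    obtain ⟨m, hm⟩ := IntermediateField.finrank_dvd_of_le_right hFE
    have hm0 : m ≠ 0 := by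
      rintro rfl
      have := Module.finrank_pos (R := ℚ) (M := E)
      omega
    have hm1 : m ≠ 1 := by
      rintro rfl
      exact hF ((IntermediateField.eq_of_le_of_finrank_eq hFE (by omega)) ▸ hE)
    rw [hm]
    exact Nat.mul_le_mul ih (by omega)

instance isGalois_multiquadraticField {n : ℕ} (a : Fin n → ℕ) :
    IsGalois ℚ (multiquadraticField a) := by
  set p : Polynomial ℚ := ∏ i, (Polynomial.X ^ 2 - Polynomial.C (a i : ℚ)) with hp
  have hp0 : p ≠ 0 := Finset.prod_ne_zero_iff.mpr fun i _ =>
    (Polynomial.monic_X_pow_sub_C _ two_ne_zero).ne_zero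
  have hfac (i : Fin n) : (Polynomial.X ^ 2 - Polynomial.C (a i : ℚ)).map (algebraMap ℚ ℝ) =
      (Polynomial.X - Polynomial.C √(a i : ℝ)) * (Polynomial.X - Polynomial.C (-√(a i : ℝ))) := by
    have h : (Polynomial.C √(a i : ℝ)) ^ 2 = Polynomial.C (a i : ℝ) := by
      rw [← Polynomial.C_pow, Real.sq_sqrt (Nat.cast_nonneg _)]
    simp only [Polynomial.map_sub, Polynomial.map_pow, Polynomial.map_X, Polynomial.map_natCast,
      map_natCast, Polynomial.C_neg] at h ⊢
    linear_combination h
  have hsplits : (p.map (algebraMap ℚ ℝ)).Splits := by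
    rw [hp, Polynomial.map_prod]
    refine Polynomial.Splits.prod fun i _ => ?_
    rw [hfac]
    exact (Polynomial.Splits.X_sub_C _).mul (Polynomial.Splits.X_sub_C _)
  have hK : multiquadraticField a = IntermediateField.adjoin ℚ (p.rootSet ℝ) := by
    have hroot (x : ℝ) : x ∈ p.rootSet ℝ ↔ ∃ i, x = √(a i : ℝ) ∨ x = -√(a i : ℝ) := by
      rw [Polynomial.mem_rootSet_of_ne hp0, Polynomial.aeval_def, ← Polynomial.eval_map, hp,
        Polynomial.map_prod, Polynomial.eval_prod, Finset.prod_eq_zero_iff]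
      refine exists_congr fun i => ?_
      rw [hfac]
      simp [sub_eq_zero, add_eq_zero_iff_eq_neg]
    refine le_antisymm (IntermediateField.adjoin.mono _ _ _ ?_)
      (IntermediateField.adjoin_le_iff.mpr ?_)
    · rintro _ ⟨i, rfl⟩
      exact (hroot _).mpr ⟨i, Or.inl rfl⟩
    · intro x hx
      obtain ⟨i, hi⟩ := (hroot x).mp hx
      have hmem : √(a i : ℝ) ∈ multiquadraticField a :=
        IntermediateField.subset_adjoin ℚ _ ⟨i, rfl⟩
      rcases hi with rfl | rfl
      · exact hmem
      · exact neg_mem hmem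
  rw [hK]
  have : Normal ℚ (IntermediateField.adjoin ℚ (p.rootSet ℝ)) :=
    Normal.of_isSplittingField (hFEp := IntermediateField.adjoin_rootSet_isSplittingField hsplits)
  exact ⟨⟩

/-- A multiquadratic field whose generators are independent modulo squares has the largest
possible Galois group: the signs `σ(√aᵢ)/√aᵢ` embed the group into `(ℤ/2ℤ)ⁿ`, and its order is at
least `2ⁿ`. -/
lemma nonempty_gal_mulEquiv {n : ℕ} (a : Fin n → ℕ)
    (h : ∀ I : Finset (Fin n), I.Nonempty → ¬ IsSquare (∏ i ∈ I, a i)) :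
    Nonempty (Gal(multiquadraticField a/ℚ) ≃* Multiplicative (Fin n → ZMod 2)) := by
  classical
  have hKa : multiquadraticField a = IntermediateField.adjoin ℚ
      ((fun i => √(a i : ℝ)) '' ((Finset.univ : Finset (Fin n)) : Set (Fin n))) := by
    simp [multiquadraticField, Set.image_univ]
  have hfin : FiniteDimensional ℚ (multiquadraticField a) := by
    rw [hKa]; exact finiteDimensional_adjoin_sqrt a (Finset.finite_toSet _)
  have hdeg : 2 ^ n ≤ Nat.card Gal(multiquadraticField a/ℚ) := by
    rw [IsGalois.card_aut_eq_finrank, hKa]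
    simpa using two_pow_card_le_finrank_adjoin_sqrt a h Finset.univ
  set g : Fin n → multiquadraticField a := fun i =>
    ⟨√(a i : ℝ), IntermediateField.subset_adjoin ℚ _ ⟨i, rfl⟩⟩ with hg
  have hg2 (i : Fin n) : g i ^ 2 = (a i : multiquadraticField a) := by
    apply Subtype.ext
    simp [hg, Real.sq_sqrt (Nat.cast_nonneg (a i))]
  have hsign (σ : Gal(multiquadraticField a/ℚ)) (i : Fin n) : σ (g i) = g i ∨ σ (g i) = -g i := by
    rw [← sq_eq_sq_iff_eq_or_eq_neg, ← map_pow, hg2, map_natCast]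
  let f : Gal(multiquadraticField a/ℚ) →* Multiplicative (Fin n → ZMod 2) :=
    { toFun := fun σ => Multiplicative.ofAdd fun i => if σ (g i) = g i then 0 else 1
      map_one' := by
        simp only [AlgEquiv.one_apply, if_true]
        rfl
      map_mul' := fun σ τ => by
        rw [← ofAdd_add]
        congr 1
        funext i
        have h2 : (1 : ZMod 2) + 1 = 0 := rfl
        by_cases h0 : g i = -g i
        · have hs (σ : Gal(multiquadraticField a/ℚ)) : σ (g i) = g i :=
            (hsign σ i).elim id fun hσ => hσ.trans h0.symm
          simp [hs]
        · rcases hsign σ i with hσ | hσ <;> rcases hsign τ i with hτ | hτ <;>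
            simp [AlgEquiv.mul_apply, hσ, hτ, h2, Ne.symm h0] }
  have hf : Function.Injective f := by
    refine (injective_iff_map_eq_one f).mpr fun σ hσ => ?_
    have hfix (i : Fin n) : σ (g i) = g i := by
      by_contra hne
      have := congrFun (congrArg Multiplicative.toAdd hσ) i
      simp [f, hne] at this
    have : (σ : multiquadraticField a →ₐ[ℚ] multiquadraticField a) = AlgHom.id ℚ _ := by
      refine IntermediateField.algHom_ext_of_eq_adjoin ℚ
        (s := Set.range fun i => √(a i : ℝ)) rfl ?_
      rintro _ ⟨i, rfl⟩
      exact hfix i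
    exact AlgEquiv.ext fun x => DFunLike.congr_fun this x
  have hcard : Nat.card (Multiplicative (Fin n → ZMod 2)) = 2 ^ n := by simp
  have hbij : Function.Bijective f :=
    (Nat.bijective_iff_injective_and_card f).mpr
      ⟨hf, le_antisymm (Nat.card_le_card_of_injective f hf) (hcard ▸ hdeg)⟩
  exact ⟨MulEquiv.ofBijective f hbij⟩

/-! ### Nondegenerate tuples and their fields -/

/-- The squarefree numbers in `[1, H]`. -/
def squarefreeUpTo (H : ℕ) : Finset ℕ := {m ∈ Finset.Icc 1 H | Squarefree m}

lemma mem_squarefreeUpTo {H m : ℕ} : m ∈ squarefreeUpTo H ↔ 1 ≤ m ∧ m ≤ H ∧ Squarefree m := by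
  simp [squarefreeUpTo, and_assoc]

/-- Tuples for which the field `ℚ(√s₁, …, √sₙ)` may contain the square root of some squarefree
number up to `H` other than `1, s₁, …, sₙ`, or may have degree less than `2ⁿ`. -/
def IsDegenerate {n : ℕ} (H : ℕ) (s : Fin n → ℕ) : Prop :=
  (∃ i, s i = 1) ∨ ∃ I : Finset (Fin n), 2 ≤ I.card ∧
    ∃ z ∈ Finset.Icc 1 H, IsSquare (z * ∏ i ∈ I, s i)

open Classical in
/-- The tuples of squarefree numbers up to `H` that are degenerate. -/
noncomputable def degenerateTuples (n H : ℕ) : Finset (Fin n → ℕ) :=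
  {s ∈ Fintype.piFinset fun _ : Fin n => squarefreeUpTo H | IsDegenerate H s}

open Classical in
/-- The tuples of squarefree numbers up to `H` that are not degenerate. -/
noncomputable def nondegenerateTuples (n H : ℕ) : Finset (Fin n → ℕ) :=
  {s ∈ Fintype.piFinset fun _ : Fin n => squarefreeUpTo H | ¬ IsDegenerate H s}

lemma Squarefree.dvd_of_isSquare_mul {u z : ℕ} (hu : Squarefree u) (h : IsSquare (z * u)) :
    u ∣ z := by
  obtain ⟨m, hm⟩ := h
  have hum : u ∣ m := (hu.dvd_pow_iff_dvd two_ne_zero).mp ⟨z, by rw [pow_two, ← hm, mul_comm]⟩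
  obtain ⟨k, rfl⟩ := hum
  refine ⟨k * k, Nat.eq_of_mul_eq_mul_right (Nat.pos_of_ne_zero hu.ne_zero) ?_⟩
  rw [hm]; ring

lemma Squarefree.eq_of_isSquare_mul {d e : ℕ} (hd : Squarefree d) (he : Squarefree e)
    (h : IsSquare (d * e)) : d = e :=
  Nat.dvd_antisymm (hd.dvd_of_isSquare_mul (mul_comm d e ▸ h)) (he.dvd_of_isSquare_mul h)

section Nondegenerate

variable {n H : ℕ} {s t : Fin n → ℕ}

lemma mem_nondegenerateTuples :
    s ∈ nondegenerateTuples n H ↔ (∀ i, s i ∈ squarefreeUpTo H) ∧ ¬ IsDegenerate H s := by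
  simp [nondegenerateTuples]

lemma mem_degenerateTuples :
    s ∈ degenerateTuples n H ↔ (∀ i, s i ∈ squarefreeUpTo H) ∧ IsDegenerate H s := by
  simp [degenerateTuples]

lemma card_le_one_of_not_isDegenerate (hs : ¬ IsDegenerate H s) {I : Finset (Fin n)} {z : ℕ}
    (hz : 1 ≤ z) (hzH : z ≤ H) (h : IsSquare (z * ∏ i ∈ I, s i)) : I.card ≤ 1 := by
  by_contra! hI
  exact hs (Or.inr ⟨I, hI, z, Finset.mem_Icc.mpr ⟨hz, hzH⟩, h⟩)

lemma injective_of_mem_nondegenerateTuples (hs : s ∈ nondegenerateTuples n H) :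
    Function.Injective s := by
  rw [mem_nondegenerateTuples] at hs
  intro i j hij
  by_contra hne
  have h1 := mem_squarefreeUpTo.mp (hs.1 i)
  have := card_le_one_of_not_isDegenerate hs.2 (I := {i, j}) (le_refl 1) (h1.1.trans h1.2.1)
    ⟨s i, by rw [Finset.prod_pair hne, hij, one_mul]⟩
  rw [Finset.card_pair hne] at this
  omega

lemma not_isSquare_prod_of_mem_nondegenerateTuples (hs : s ∈ nondegenerateTuples n H)
    {I : Finset (Fin n)} (hI : I.Nonempty) : ¬ IsSquare (∏ i ∈ I, s i) := by
  rw [mem_nondegenerateTuples] at hs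
  intro hsq
  obtain ⟨i, hi⟩ := hI
  have h1 := mem_squarefreeUpTo.mp (hs.1 i)
  have hcard := card_le_one_of_not_isDegenerate hs.2 (I := I) (le_refl 1) (h1.1.trans h1.2.1)
    (by rwa [one_mul])
  obtain rfl : I = {i} := Finset.eq_singleton_iff_unique_mem.mpr
    ⟨hi, fun j hj => Finset.card_le_one.mp hcard j hj i hi⟩
  rw [Finset.prod_singleton] at hsq
  exact hs.2 (Or.inl ⟨i, h1.2.2.eq_of_isSquare_mul squarefree_one (by rwa [mul_one])⟩)

/-- A nondegenerate tuple can be recovered, up to order, from its field. -/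
lemma exists_perm_of_multiquadraticField_eq (hs : s ∈ nondegenerateTuples n H)
    (ht : t ∈ nondegenerateTuples n H) (h : multiquadraticField t = multiquadraticField s) :
    ∃ σ : Equiv.Perm (Fin n), s ∘ σ = t := by
  have hinj := injective_of_mem_nondegenerateTuples ht
  rw [mem_nondegenerateTuples] at hs ht
  have hmem (j : Fin n) : ∃ i, s i = t j := by
    have hj : √(t j : ℝ) ∈ multiquadraticField s :=
      h ▸ IntermediateField.subset_adjoin ℚ _ ⟨j, rfl⟩
    obtain ⟨J, -, hJ⟩ := exists_isSquare_mul_prod_of_sqrt_mem s Finset.univ (t j) (by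
      simpa [multiquadraticField, Set.image_univ] using hj)
    obtain ⟨ht1, htH, htsq⟩ := mem_squarefreeUpTo.mp (ht.1 j)
    have hcard := card_le_one_of_not_isDegenerate hs.2 ht1 htH hJ
    rcases J.eq_empty_or_nonempty with rfl | ⟨i, hi⟩
    · exact (ht.2 (Or.inl ⟨j, htsq.eq_of_isSquare_mul squarefree_one (by simpa using hJ)⟩)).elim
    · obtain rfl : J = {i} := Finset.eq_singleton_iff_unique_mem.mpr
        ⟨hi, fun j hj => Finset.card_le_one.mp hcard j hj i hi⟩
      rw [Finset.prod_singleton] at hJ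
      exact ⟨i, (htsq.eq_of_isSquare_mul (mem_squarefreeUpTo.mp (hs.1 i)).2.2 hJ).symm⟩
  choose f hf using hmem
  have hfinj : Function.Injective f := fun i j hij => hinj (by rw [← hf, ← hf, hij])
  exact ⟨Equiv.ofBijective f (Finite.injective_iff_bijective.mp hfinj), funext hf⟩

lemma multiquadraticField_comp_perm (σ : Equiv.Perm (Fin n)) :
    multiquadraticField (s ∘ σ) = multiquadraticField s := by
  unfold multiquadraticField
  congr 1
  exact σ.surjective.range_comp fun i => √(s i : ℝ)

lemma comp_perm_mem_nondegenerateTuples (hs : s ∈ nondegenerateTuples n H)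
    (σ : Equiv.Perm (Fin n)) : s ∘ σ ∈ nondegenerateTuples n H := by
  rw [mem_nondegenerateTuples] at hs ⊢
  refine ⟨fun i => hs.1 _, fun hd => hs.2 ?_⟩
  rcases hd with ⟨i, hi⟩ | ⟨I, hI, z, hz, hsq⟩
  · exact Or.inl ⟨σ i, hi⟩
  · refine Or.inr ⟨I.map σ.toEmbedding, by rwa [Finset.card_map], z, hz, ?_⟩
    rwa [Finset.prod_map]

end Nondegenerate

open Classical in
lemma card_nondegenerateTuples (n H : ℕ) :
    (nondegenerateTuples n H).card =
      n ! * ((nondegenerateTuples n H).image multiquadraticField).card := by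
  rw [Finset.card_eq_sum_card_image multiquadraticField, Finset.sum_const_nat (m := n !),
    mul_comm]
  intro K hK
  obtain ⟨s, hs, rfl⟩ := Finset.mem_image.mp hK
  have : {t ∈ nondegenerateTuples n H | multiquadraticField t = multiquadraticField s} =
      Finset.univ.image fun σ : Equiv.Perm (Fin n) => s ∘ σ := by
    ext t
    simp only [Finset.mem_filter, Finset.mem_image, Finset.mem_univ, true_and]
    refine ⟨fun ⟨ht, h⟩ => exists_perm_of_multiquadraticField_eq hs ht h, ?_⟩
    rintro ⟨σ, rfl⟩
    exact ⟨comp_perm_mem_nondegenerateTuples hs σ, multiquadraticField_comp_perm σ⟩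
  rw [this, Finset.card_image_of_injective, Finset.card_univ, Fintype.card_perm, Fintype.card_fin]
  intro σ τ hστ
  exact Equiv.ext fun i => injective_of_mem_nondegenerateTuples hs (congrFun hστ i)

/-- Replacing each generator by its squarefree part does not change the field. -/
lemma exists_squarefree_multiquadraticField_eq {n H : ℕ} (a : Fin n → ℕ)
    (ha : ∀ i, 1 ≤ a i ∧ a i ≤ H) :
    ∃ s : Fin n → ℕ, (∀ i, s i ∈ squarefreeUpTo H) ∧
      multiquadraticField s = multiquadraticField a := by
  choose s b hs hb hba hsq using fun i => Nat.sq_mul_squarefree_of_pos (ha i).1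
  have hsqrt (i : Fin n) : √(a i : ℝ) = b i * √(s i : ℝ) := by
    rw [← hba i]
    push_cast
    rw [Real.sqrt_mul (by positivity), Real.sqrt_sq (Nat.cast_nonneg _)]
  refine ⟨s, fun i => mem_squarefreeUpTo.mpr ⟨hs i, ?_, hsq i⟩, le_antisymm ?_ ?_⟩
  · refine le_trans ?_ (ha i).2
    rw [← hba i]
    exact Nat.le_mul_of_pos_left _ (pow_pos (hb i) 2)
  · refine IntermediateField.adjoin_le_iff.mpr ?_
    rintro _ ⟨i, rfl⟩
    have hmem : √(a i : ℝ) ∈ multiquadraticField a :=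
      IntermediateField.subset_adjoin ℚ _ ⟨i, rfl⟩
    have hb0 : (b i : ℝ) ≠ 0 := by exact_mod_cast (hb i).ne'
    have : √(s i : ℝ) = (b i : ℝ)⁻¹ * √(a i : ℝ) := by rw [hsqrt]; field_simp
    show √(s i : ℝ) ∈ multiquadraticField a
    rw [this]
    exact mul_mem (inv_mem (natCast_mem _ _)) hmem
  · refine IntermediateField.adjoin_le_iff.mpr ?_
    rintro _ ⟨i, rfl⟩
    show √(a i : ℝ) ∈ multiquadraticField s
    rw [hsqrt]
    exact mul_mem (natCast_mem _ _) (IntermediateField.subset_adjoin ℚ _ ⟨i, rfl⟩)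

/-- The count of fields differs from the number of `n`-subsets of squarefree numbers, in the form
`Qⁿ / n!`, by at most twice the number of degenerate tuples. -/
lemma abs_maxGaloisCount_sub_le (n H : ℕ) :
    |(maxGaloisCount n H : ℝ) - ((squarefreeUpTo H).card : ℝ) ^ n / n !| ≤
      2 * (degenerateTuples n H).card := by
  classical
  set G := (nondegenerateTuples n H).image multiquadraticField with hG
  set B := (degenerateTuples n H).image multiquadraticField with hB
  have hlow : G.card ≤ maxGaloisCount n H := by
    rw [← Set.ncard_coe_finset]
    refine Set.ncard_le_ncard ?_ (maxGaloisFields_finite n H)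
    intro K hK
    obtain ⟨s, hs, rfl⟩ := Finset.mem_image.mp (Finset.mem_coe.mp hK)
    refine ⟨s, fun i => ?_, rfl, nonempty_gal_mulEquiv s fun I hI =>
      not_isSquare_prod_of_mem_nondegenerateTuples hs hI⟩
    have := mem_squarefreeUpTo.mp ((mem_nondegenerateTuples.mp hs).1 i)
    exact ⟨this.1, this.2.1⟩
  have hup : maxGaloisCount n H ≤ G.card + (degenerateTuples n H).card := by
    have h1 : maxGaloisCount n H ≤ (G ∪ B).card := by
      rw [← Set.ncard_coe_finset]
      refine Set.ncard_le_ncard ?_ (Finset.finite_toSet _)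
      rintro K ⟨a, ha, rfl, -⟩
      obtain ⟨s, hs, hsa⟩ := exists_squarefree_multiquadraticField_eq a ha
      rw [Finset.mem_coe, Finset.mem_union, ← hsa]
      by_cases hd : IsDegenerate H s
      · exact Or.inr (Finset.mem_image_of_mem _ (mem_degenerateTuples.mpr ⟨hs, hd⟩))
      · exact Or.inl (Finset.mem_image_of_mem _ (mem_nondegenerateTuples.mpr ⟨hs, hd⟩))
    exact h1.trans ((Finset.card_union_le _ _).trans
      (Nat.add_le_add_left Finset.card_image_le _))
  have hsum : (degenerateTuples n H).card + n ! * G.card = (squarefreeUpTo H).card ^ n := by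
    rw [hG, ← card_nondegenerateTuples, degenerateTuples, nondegenerateTuples,
      Finset.card_filter_add_card_filter_not]
    simp
  have hfac : (1 : ℝ) ≤ n ! := by exact_mod_cast n.factorial_pos
  have hQ : ((squarefreeUpTo H).card : ℝ) ^ n / n ! =
      G.card + (degenerateTuples n H).card / n ! := by
    rw [div_eq_iff (by positivity), add_mul, div_mul_cancel₀ _ (by positivity)]
    have : ((degenerateTuples n H).card : ℝ) + n ! * G.card = (squarefreeUpTo H).card ^ n := by
      exact_mod_cast hsum
    linarith
  have hlow' : (G.card : ℝ) ≤ maxGaloisCount n H := by exact_mod_cast hlow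
  have hup' : (maxGaloisCount n H : ℝ) ≤ G.card + (degenerateTuples n H).card := by
    exact_mod_cast hup
  have h0 : (0 : ℝ) ≤ (degenerateTuples n H).card / n ! := by positivity
  have h1 : ((degenerateTuples n H).card : ℝ) / n ! ≤ (degenerateTuples n H).card :=
    div_le_self (Nat.cast_nonneg _) hfac
  rw [hQ, abs_le]
  constructor <;> linarith

/-! ### Counting degenerate tuples -/

lemma card_squarefreeUpTo_le (H : ℕ) : (squarefreeUpTo H).card ≤ H :=
  (Finset.card_filter_le _ _).trans (by simp)

/-- Counting tuples by fixing all coordinates but one. -/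
lemma card_filter_piFinset_le {n : ℕ} (A : Finset ℕ) (i : Fin n) (P : (Fin n → ℕ) → Prop)
    [DecidablePred P] {B : ℝ} (hB : 0 ≤ B)
    (h : ∀ s ∈ Fintype.piFinset fun _ : Fin n => A,
      (({x ∈ A | P (Function.update s i x)} : Finset ℕ).card : ℝ) ≤ B) :
    (({s ∈ Fintype.piFinset fun _ : Fin n => A | P s} : Finset (Fin n → ℕ)).card : ℝ) ≤
      B * (A.card : ℝ) ^ (n - 1) := by
  classical
  set X := {s ∈ Fintype.piFinset fun _ : Fin n => A | P s} with hX
  set R := Fintype.piFinset fun _ : {j : Fin n // j ≠ i} => A with hR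
  have hRcard : R.card = A.card ^ (n - 1) := by
    rw [hR, Fintype.card_piFinset, Finset.prod_const, Finset.card_univ, Fintype.card_subtype_compl]
    simp
  have hfib : ∀ b ∈ R, ({s ∈ X | (fun j : {j : Fin n // j ≠ i} => s j) = b}.card : ℝ) ≤ B := by
    intro b hb
    rcases ({s ∈ X | (fun j : {j : Fin n // j ≠ i} => s j) = b}).eq_empty_or_nonempty with
      h0 | ⟨s, hs⟩
    · rw [h0]; simpa using hB
    obtain ⟨hsX, hsb⟩ := Finset.mem_filter.mp hs
    refine le_trans ?_ (h s (Finset.mem_filter.mp hsX).1)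
    have hupd : ∀ t ∈ {s ∈ X | (fun j : {j : Fin n // j ≠ i} => s j) = b},
        Function.update s i (t i) = t := by
      intro t ht
      have htb := (Finset.mem_filter.mp ht).2
      funext j
      by_cases hj : j = i
      · subst hj; simp
      · rw [Function.update_of_ne hj]
        exact congrFun (hsb.trans htb.symm) ⟨j, hj⟩
    refine Nat.cast_le.mpr (Finset.card_le_card_of_injOn (fun t => t i) ?_ ?_)
    · intro t ht
      have htX := Finset.mem_filter.mp (Finset.mem_filter.mp ht).1
      refine Finset.mem_coe.mpr (Finset.mem_filter.mpr ⟨Fintype.mem_piFinset.mp htX.1 i, ?_⟩)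
      rw [hupd t ht]
      exact htX.2
    · intro t ht t' ht' htt'
      rw [← hupd t ht, ← hupd t' ht']
      exact congrArg (Function.update s i) htt'
  rw [Finset.card_eq_sum_card_fiberwise (f := fun s (j : {j : Fin n // j ≠ i}) => s j) (t := R)]
  · push_cast
    refine (Finset.sum_le_card_nsmul R _ B hfib).trans (le_of_eq ?_)
    rw [hRcard, nsmul_eq_mul]
    push_cast
    ring
  · intro s hs
    have := Fintype.mem_piFinset.mp (Finset.mem_filter.mp hs).1
    exact Fintype.mem_piFinset.mpr fun j => this j

lemma isSquare_of_isSquare_sq_mul {k m : ℕ} (hk : k ≠ 0) (h : IsSquare (k ^ 2 * m)) :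
    IsSquare m := by
  obtain ⟨r, hr⟩ := h
  have hkr : k ∣ r := (Nat.pow_dvd_pow_iff two_ne_zero).mp ⟨m, by rw [hr]; ring⟩
  obtain ⟨q, rfl⟩ := hkr
  refine ⟨q, Nat.eq_of_mul_eq_mul_left (pow_pos (Nat.pos_of_ne_zero hk) 2) ?_⟩
  rw [hr]; ring

open Classical in
/-- For fixed `c` the squarefree part of `x c` determines the squarefree number `x`. -/
lemma card_filter_exists_isSquare_le (A : Finset ℕ) (hA : ∀ x ∈ A, Squarefree x) (T c : ℕ)
    (hc : c ≠ 0) :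
    ({x ∈ A | ∃ w ∈ Finset.Icc 1 T, IsSquare (w * (x * c))} : Finset ℕ).card ≤ T := by
  have hw (x : ℕ) : ∃ w, (∃ w ∈ Finset.Icc 1 T, IsSquare (w * (x * c))) →
      w ∈ Finset.Icc 1 T ∧ IsSquare (w * (x * c)) := by
    by_cases h : ∃ w ∈ Finset.Icc 1 T, IsSquare (w * (x * c))
    · obtain ⟨w, hw⟩ := h
      exact ⟨w, fun _ => hw⟩
    · exact ⟨0, fun h' => (h h').elim⟩
  choose f hf using hw
  calc _ ≤ (Finset.Icc 1 T).card := Finset.card_le_card_of_injOn f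
        (fun x hx => (hf x (Finset.mem_filter.mp hx).2).1) ?_
    _ = T := by simp
  intro x hx y hy hxy
  obtain ⟨hxA, hx⟩ := Finset.mem_filter.mp (Finset.mem_coe.mp hx)
  obtain ⟨hyA, hy⟩ := Finset.mem_filter.mp (Finset.mem_coe.mp hy)
  have hx' := hf x hx
  have hy' := hf y hy
  rw [← hxy] at hy'
  have hf0 : f x ≠ 0 := by have := (Finset.mem_Icc.mp hx'.1).1; omega
  refine (hA x hxA).eq_of_isSquare_mul (hA y hyA)
    (isSquare_of_isSquare_sq_mul (mul_ne_zero hf0 hc) ?_)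
  rw [show (f x * c) ^ 2 * (x * y) = f x * (x * c) * (f x * (y * c)) by ring]
  exact hx'.2.mul hy'.2

open Classical in
/-- If `w` is large, few squarefree `y ≤ H` make the squarefree part of `w y` as small as `H`:
with `d = gcd(w, y)` and `y = d t`, both `d t` and `(w / d) t` are at most `H`. -/
lemma card_filter_exists_isSquare_mul_le {H w : ℕ} (hw : Squarefree w) :
    ({y ∈ squarefreeUpTo H | ∃ z ∈ Finset.Icc 1 H, IsSquare (z * (w * y))} : Finset ℕ).card ≤
      w.divisors.card * Nat.sqrt (H ^ 2 / w) := by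
  have hsub : ({y ∈ squarefreeUpTo H | ∃ z ∈ Finset.Icc 1 H, IsSquare (z * (w * y))} : Finset ℕ) ⊆
      (w.divisors ×ˢ Finset.Icc 1 (Nat.sqrt (H ^ 2 / w))).image fun p => p.1 * p.2 := by
    intro y hy
    rw [Finset.mem_filter, mem_squarefreeUpTo] at hy
    obtain ⟨⟨hy1, hyH, hysq⟩, z, hz, hsq⟩ := hy
    obtain ⟨hz1, hzH⟩ := Finset.mem_Icc.mp hz
    have hw0 : 0 < w := Nat.pos_of_ne_zero hw.ne_zero
    set d := Nat.gcd w y with hd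
    have hd0 : 0 < d := Nat.gcd_pos_of_pos_left _ hw0
    obtain ⟨u, hu⟩ : d ∣ w := Nat.gcd_dvd_left w y
    obtain ⟨t, ht⟩ : d ∣ y := Nat.gcd_dvd_right w y
    have hcop : Nat.Coprime u t := by
      have := Nat.coprime_div_gcd_div_gcd (m := w) (n := y) hd0
      rwa [← hd, Nat.div_eq_of_eq_mul_right hd0 hu, Nat.div_eq_of_eq_mul_right hd0 ht] at this
    have hut : Squarefree (u * t) := (Nat.squarefree_mul hcop).mpr
      ⟨hw.squarefree_of_dvd ⟨d, by rw [hu, mul_comm]⟩,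
        hysq.squarefree_of_dvd ⟨d, by rw [ht, mul_comm]⟩⟩
    have huz : u * t ∣ z := by
      refine hut.dvd_of_isSquare_mul (isSquare_of_isSquare_sq_mul hd0.ne' ?_)
      convert hsq using 1
      rw [hu, ht]; ring
    have hutH : u * t ≤ H := (Nat.le_of_dvd hz1 huz).trans hzH
    have ht0 : 0 < t := Nat.pos_of_ne_zero (by rintro rfl; omega)
    refine Finset.mem_image.mpr ⟨(d, t), Finset.mem_product.mpr
      ⟨Nat.mem_divisors.mpr ⟨⟨u, hu⟩, hw0.ne'⟩, Finset.mem_Icc.mpr ⟨ht0, ?_⟩⟩, ht.symm⟩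
    rw [Nat.le_sqrt', Nat.le_div_iff_mul_le hw0]
    calc t ^ 2 * w = (d * t) * (u * t) := by rw [hu]; ring
      _ ≤ H * H := Nat.mul_le_mul (ht ▸ hyH) hutH
      _ = H ^ 2 := by ring
  calc _ ≤ _ := Finset.card_le_card hsub
    _ ≤ _ := Finset.card_image_le
    _ = _ := by rw [Finset.card_product]; simp

/-- The divisor bound `τ(w) ≪ w^{1/k}` for squarefree `w`: each prime `p ≥ 2ᵏ` contributes
`2ᵏ ≤ p` to `τ(w)ᵏ`, and there are fewer than `2ᵏ` other primes. -/
lemma Squarefree.card_divisors_pow_le {w : ℕ} (hw : Squarefree w) (k : ℕ) :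
    w.divisors.card ^ k ≤ (2 ^ k) ^ (2 ^ k) * w := by
  have hτ : w.divisors.card ≤ ∏ _p ∈ w.primeFactors, 2 := by
    rw [Nat.card_divisors hw.ne_zero]
    refine Finset.prod_le_prod' fun p _ => ?_
    have := hw.natFactorization_le_one p
    omega
  calc w.divisors.card ^ k ≤ (∏ _p ∈ w.primeFactors, 2) ^ k := Nat.pow_le_pow_left hτ k
    _ = ∏ _p ∈ w.primeFactors, 2 ^ k := by rw [Finset.prod_pow]
    _ ≤ ∏ p ∈ w.primeFactors, (if p < 2 ^ k then 2 ^ k else 1) * p := by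
        refine Finset.prod_le_prod' fun p hp => ?_
        have hp0 := (Nat.prime_of_mem_primeFactors hp).pos
        split_ifs with h
        · exact Nat.le_mul_of_pos_right _ hp0
        · omega
    _ = (∏ p ∈ w.primeFactors, if p < 2 ^ k then 2 ^ k else 1) * w := by
        rw [Finset.prod_mul_distrib, Nat.prod_primeFactors_of_squarefree hw]
    _ ≤ (2 ^ k) ^ (2 ^ k) * w := by
        refine Nat.mul_le_mul_right _ ?_
        rw [← Finset.prod_filter, Finset.prod_const]
        refine Nat.pow_le_pow_right (by positivity) ?_
        calc _ ≤ (Finset.range (2 ^ k)).card := Finset.card_le_card fun p hp => by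
              simpa using (Finset.mem_filter.mp hp).2
          _ = 2 ^ k := by simp

open Classical in
/-- For tuples, with `c` the product of the coordinates in `I` other than `j`, either the
squarefree part `w` of `c` is at most `√H`, which restricts another coordinate of `I`, or it is
large, which restricts the coordinate `j`. -/
lemma exists_card_filter_exists_isSquare_prod_le (n : ℕ) :
    ∃ C : ℝ, 0 ≤ C ∧ ∀ (H : ℕ) (I : Finset (Fin n)), 1 ≤ H → 2 ≤ I.card →
      (({s ∈ Fintype.piFinset fun _ : Fin n => squarefreeUpTo H |
        ∃ z ∈ Finset.Icc 1 H, IsSquare (z * ∏ i ∈ I, s i)} : Finset (Fin n → ℕ)).card : ℝ) ≤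
      C * (H : ℝ) ^ n * (H : ℝ) ^ (-(1 / 8) : ℝ) := by
  set C₀ : ℝ := (((2 ^ (8 * n)) ^ (2 ^ (8 * n)) : ℕ) : ℝ) with hC₀
  refine ⟨1 + C₀, by positivity, fun H I hH hI => ?_⟩
  have hH1 : (1 : ℝ) ≤ H := by exact_mod_cast hH
  have hH0 : (0 : ℝ) < H := by linarith
  obtain ⟨i, hi, j, hj, hij⟩ := Finset.one_lt_card.mp hI
  have hn : 1 ≤ n := by have := i.pos; omega
  set S := squarefreeUpTo H with hS
  set T := Nat.sqrt H with hT
  set P₁ : (Fin n → ℕ) → Prop := fun s =>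
    ∃ w ∈ Finset.Icc 1 T, IsSquare (w * ∏ k ∈ I.erase j, s k) with hP₁
  set P₂ : (Fin n → ℕ) → Prop := fun s =>
    ¬ P₁ s ∧ ∃ z ∈ Finset.Icc 1 H, IsSquare (z * ∏ k ∈ I, s k) with hP₂
  have hSn : (S.card : ℝ) ^ (n - 1) ≤ (H : ℝ) ^ (n - 1) :=
    pow_le_pow_left₀ (Nat.cast_nonneg _) (by exact_mod_cast card_squarefreeUpTo_le H) _
  have hpos {s : Fin n → ℕ} (hs : s ∈ Fintype.piFinset fun _ : Fin n => S) (k : Fin n) :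
      1 ≤ s k ∧ s k ≤ H := by
    have := mem_squarefreeUpTo.mp (Fintype.mem_piFinset.mp hs k)
    exact ⟨this.1, this.2.1⟩
  have hprod (s : Fin n → ℕ) (x : ℕ) {k : Fin n} {J : Finset (Fin n)} (hk : k ∈ J) :
      ∏ l ∈ J, Function.update s k x l = x * ∏ l ∈ J.erase k, s l := by
    rw [Finset.prod_update_of_mem hk, Finset.erase_eq]
  have h₁ : (({s ∈ Fintype.piFinset fun _ : Fin n => S | P₁ s} : Finset (Fin n → ℕ)).card : ℝ) ≤
      (H : ℝ) ^ (7 / 8 : ℝ) * (S.card : ℝ) ^ (n - 1) := by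
    refine card_filter_piFinset_le S i P₁ (by positivity) fun s hs => ?_
    have hij' : i ∈ I.erase j := Finset.mem_erase.mpr ⟨hij, hi⟩
    simp only [hP₁, hprod s _ hij']
    have hc : ∏ k ∈ (I.erase j).erase i, s k ≠ 0 :=
      Finset.prod_ne_zero_iff.mpr fun k _ => Nat.one_le_iff_ne_zero.mp (hpos hs k).1
    have := card_filter_exists_isSquare_le S (fun x hx => (mem_squarefreeUpTo.mp hx).2.2) T _ hc
    calc _ ≤ (T : ℝ) := by exact_mod_cast this
      _ ≤ √(H : ℝ) := Real.nat_sqrt_le_real_sqrt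
      _ = (H : ℝ) ^ (1 / 2 : ℝ) := Real.sqrt_eq_rpow _
      _ ≤ (H : ℝ) ^ (7 / 8 : ℝ) := Real.rpow_le_rpow_of_exponent_le hH1 (by norm_num)
  have h₂ : (({s ∈ Fintype.piFinset fun _ : Fin n => S | P₂ s} : Finset (Fin n → ℕ)).card : ℝ) ≤
      (C₀ * (H : ℝ) ^ (7 / 8 : ℝ)) * (S.card : ℝ) ^ (n - 1) := by
    refine card_filter_piFinset_le S j P₂ (by positivity) fun s hs => ?_
    set c := ∏ k ∈ I.erase j, s k with hc
    have hc0 : 0 < c := Finset.prod_pos fun k _ => (hpos hs k).1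
    have hcH : c ≤ H ^ n := by
      calc c ≤ ∏ _k ∈ I.erase j, H := Finset.prod_le_prod' fun k _ => (hpos hs k).2
        _ = H ^ (I.erase j).card := by simp
        _ ≤ H ^ n := Nat.pow_le_pow_right hH (by simpa using Finset.card_le_univ (I.erase j))
    have hP₁s (x : ℕ) : P₁ (Function.update s j x) ↔ ∃ w ∈ Finset.Icc 1 T, IsSquare (w * c) := by
      have : ∏ k ∈ I.erase j, Function.update s j x k = c :=
        Finset.prod_congr rfl fun k hk => Function.update_of_ne (Finset.ne_of_mem_erase hk) _ _
      simp only [hP₁, this]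
    simp only [hP₂, hP₁s, hprod s _ hj, ← hc]
    by_cases hsmall : ∃ w ∈ Finset.Icc 1 T, IsSquare (w * c)
    · simp only [hsmall, not_true_eq_false, false_and, Finset.filter_false, Finset.card_empty,
        Nat.cast_zero]
      positivity
    simp only [hsmall, not_false_eq_true, true_and]
    obtain ⟨w, b, hw0, hb0, hbw, hwsq⟩ := Nat.sq_mul_squarefree_of_pos hc0
    have hwT : T < w := by
      by_contra! hle
      exact hsmall ⟨w, Finset.mem_Icc.mpr ⟨hw0, hle⟩, b * w, by rw [← hbw]; ring⟩
    have hwH : w ≤ H ^ n :=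
      (Nat.le_of_dvd hc0 ⟨b ^ 2, by rw [← hbw, mul_comm]⟩).trans hcH
    have hcount : ({x ∈ S | ∃ z ∈ Finset.Icc 1 H, IsSquare (z * (x * c))} : Finset ℕ).card ≤
        w.divisors.card * Nat.sqrt (H ^ 2 / w) := by
      refine (Finset.card_le_card ?_).trans (card_filter_exists_isSquare_mul_le hwsq)
      intro x hx
      obtain ⟨hxS, z, hz, hsq⟩ := Finset.mem_filter.mp hx
      refine Finset.mem_filter.mpr ⟨hxS, z, hz, isSquare_of_isSquare_sq_mul hb0.ne' ?_⟩
      rwa [show b ^ 2 * (z * (w * x)) = z * (x * (b ^ 2 * w)) by ring, hbw]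
    have hτ : (w.divisors.card : ℝ) ≤ C₀ * (H : ℝ) ^ (1 / 8 : ℝ) := by
      have h8 : (w.divisors.card : ℝ) ^ (8 * n) ≤ (C₀ * (H : ℝ) ^ (1 / 8 : ℝ)) ^ (8 * n) := by
        have hC1 : 1 ≤ C₀ := by
          rw [hC₀]; exact_mod_cast Nat.one_le_pow _ _ (by positivity)
        rw [mul_pow, ← Real.rpow_mul_natCast hH0.le]
        have he : (1 / 8 : ℝ) * ((8 * n : ℕ) : ℝ) = (n : ℝ) := by push_cast; ring
        rw [he, Real.rpow_natCast]
        calc (w.divisors.card : ℝ) ^ (8 * n) ≤ C₀ * w := by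
              rw [hC₀]; exact_mod_cast hwsq.card_divisors_pow_le (8 * n)
          _ ≤ C₀ ^ (8 * n) * (H : ℝ) ^ n := by
              refine mul_le_mul (le_self_pow₀ hC1 (by omega)) (by exact_mod_cast hwH)
                (Nat.cast_nonneg _) (by positivity)
      exact le_of_pow_le_pow_left₀ (by omega) (by positivity) h8
    have hsqrt : (Nat.sqrt (H ^ 2 / w) : ℝ) ≤ (H : ℝ) ^ (3 / 4 : ℝ) := by
      have hwR : (H : ℝ) ^ (1 / 2 : ℝ) ≤ w := by
        rw [← Real.sqrt_eq_rpow]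
        have : √(H : ℝ) < T + 1 := Real.real_sqrt_lt_nat_sqrt_succ
        have : (T : ℝ) + 1 ≤ w := by exact_mod_cast hwT
        linarith
      calc (Nat.sqrt (H ^ 2 / w) : ℝ) ≤ √((H ^ 2 / w : ℕ) : ℝ) := Real.nat_sqrt_le_real_sqrt
        _ ≤ √((H : ℝ) ^ (3 / 2 : ℝ)) := by
            refine Real.sqrt_le_sqrt (Nat.cast_div_le.trans ?_)
            rw [div_le_iff₀ (by exact_mod_cast hw0)]
            push_cast
            calc (H : ℝ) ^ 2 = (H : ℝ) ^ (3 / 2 : ℝ) * (H : ℝ) ^ (1 / 2 : ℝ) := by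
                  rw [← Real.rpow_add hH0, ← Real.rpow_natCast]; norm_num
              _ ≤ _ := mul_le_mul_of_nonneg_left hwR (by positivity)
        _ = (H : ℝ) ^ (3 / 4 : ℝ) := by
            rw [Real.sqrt_eq_rpow, ← Real.rpow_mul hH0.le]; norm_num
    calc _ ≤ (w.divisors.card : ℝ) * (Nat.sqrt (H ^ 2 / w) : ℝ) := by exact_mod_cast hcount
      _ ≤ (C₀ * (H : ℝ) ^ (1 / 8 : ℝ)) * (H : ℝ) ^ (3 / 4 : ℝ) :=
          mul_le_mul hτ hsqrt (Nat.cast_nonneg _) (by positivity)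
      _ = C₀ * (H : ℝ) ^ (7 / 8 : ℝ) := by
          rw [mul_assoc, ← Real.rpow_add hH0]; norm_num
  have hunion : {s ∈ Fintype.piFinset fun _ : Fin n => S |
      ∃ z ∈ Finset.Icc 1 H, IsSquare (z * ∏ i ∈ I, s i)} ⊆
      {s ∈ Fintype.piFinset fun _ : Fin n => S | P₁ s} ∪
        {s ∈ Fintype.piFinset fun _ : Fin n => S | P₂ s} := by
    intro s hs
    obtain ⟨hsS, hsz⟩ := Finset.mem_filter.mp hs
    by_cases h : P₁ s
    · exact Finset.mem_union_left _ (Finset.mem_filter.mpr ⟨hsS, h⟩)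
    · exact Finset.mem_union_right _ (Finset.mem_filter.mpr ⟨hsS, h, hsz⟩)
  have hpow : (H : ℝ) ^ (7 / 8 : ℝ) * (H : ℝ) ^ (n - 1) =
      (H : ℝ) ^ n * (H : ℝ) ^ (-(1 / 8) : ℝ) := by
    rw [← Real.rpow_natCast, ← Real.rpow_natCast, ← Real.rpow_add hH0, ← Real.rpow_add hH0,
      Nat.cast_sub hn]
    congr 1
    push_cast
    ring
  have hcard := (Finset.card_le_card hunion).trans (Finset.card_union_le _ _)
  calc _ ≤ _ := Nat.cast_le.mpr hcard
    _ ≤ (1 + C₀) * (H : ℝ) ^ (7 / 8 : ℝ) * (S.card : ℝ) ^ (n - 1) := by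
        push_cast; linarith
    _ ≤ (1 + C₀) * (H : ℝ) ^ (7 / 8 : ℝ) * (H : ℝ) ^ (n - 1) :=
        mul_le_mul_of_nonneg_left hSn (by positivity)
    _ = _ := by rw [mul_assoc, hpow]; ring

/-- Degenerate tuples are rarer than all tuples by a power of `H`. -/
lemma exists_card_degenerateTuples_le (n : ℕ) :
    ∃ C : ℝ, 0 ≤ C ∧ ∀ H : ℕ, 1 ≤ H →
      ((degenerateTuples n H).card : ℝ) ≤ C * (H : ℝ) ^ n * (H : ℝ) ^ (-(1 / 8) : ℝ) := by
  classical
  obtain ⟨C, hC0, hC⟩ := exists_card_filter_exists_isSquare_prod_le n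
  refine ⟨n + 2 ^ n * C, by positivity, fun H hH => ?_⟩
  have hH1 : (1 : ℝ) ≤ H := by exact_mod_cast hH
  have hH0 : (0 : ℝ) < H := by linarith
  set S := squarefreeUpTo H with hS
  set X := Fintype.piFinset fun _ : Fin n => S with hX
  have hsub : degenerateTuples n H ⊆
      (Finset.univ.biUnion fun i : Fin n => {s ∈ X | s i = 1}) ∪
      ({I : Finset (Fin n) | 2 ≤ I.card} : Finset (Finset (Fin n))).biUnion fun I =>
        {s ∈ X | ∃ z ∈ Finset.Icc 1 H, IsSquare (z * ∏ i ∈ I, s i)} := by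
    intro s hs
    have hs' := mem_degenerateTuples.mp hs
    have hsX : s ∈ X := Fintype.mem_piFinset.mpr hs'.1
    rcases hs'.2 with ⟨i, hi⟩ | ⟨I, hI, h⟩
    · exact Finset.mem_union_left _ (Finset.mem_biUnion.mpr
        ⟨i, Finset.mem_univ i, Finset.mem_filter.mpr ⟨hsX, hi⟩⟩)
    · exact Finset.mem_union_right _ (Finset.mem_biUnion.mpr
        ⟨I, by simpa using hI, Finset.mem_filter.mpr ⟨hsX, h⟩⟩)
  have hone (i : Fin n) : (({s ∈ X | s i = 1} : Finset (Fin n → ℕ)).card : ℝ) ≤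
      (H : ℝ) ^ n * (H : ℝ) ^ (-(1 / 8) : ℝ) := by
    have hn : 1 ≤ n := by have := i.pos; omega
    calc _ ≤ (1 : ℝ) * (S.card : ℝ) ^ (n - 1) := by
          refine card_filter_piFinset_le S i (fun s => s i = 1) zero_le_one fun s _ => ?_
          simp only [Function.update_self]
          have : ({x ∈ S | x = 1} : Finset ℕ).card ≤ 1 :=
            Finset.card_le_one.mpr fun a ha b hb => by
              rw [(Finset.mem_filter.mp ha).2, (Finset.mem_filter.mp hb).2]
          exact_mod_cast this
      _ ≤ (H : ℝ) ^ (n - 1) := by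
          rw [one_mul]
          exact pow_le_pow_left₀ (Nat.cast_nonneg _) (by exact_mod_cast card_squarefreeUpTo_le H) _
      _ ≤ (H : ℝ) ^ n * (H : ℝ) ^ (-(1 / 8) : ℝ) := by
          rw [← Real.rpow_natCast, ← Real.rpow_natCast, ← Real.rpow_add hH0, Nat.cast_sub hn]
          refine Real.rpow_le_rpow_of_exponent_le hH1 ?_
          push_cast
          linarith
  have h1 : ((Finset.univ.biUnion fun i : Fin n => {s ∈ X | s i = 1}).card : ℝ) ≤
      n * ((H : ℝ) ^ n * (H : ℝ) ^ (-(1 / 8) : ℝ)) := by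
    calc _ ≤ ((∑ i : Fin n, ({s ∈ X | s i = 1} : Finset (Fin n → ℕ)).card : ℕ) : ℝ) :=
          Nat.cast_le.mpr Finset.card_biUnion_le
      _ ≤ ∑ _i : Fin n, (H : ℝ) ^ n * (H : ℝ) ^ (-(1 / 8) : ℝ) := by
          push_cast
          exact Finset.sum_le_sum fun i _ => hone i
      _ = _ := by simp
  have h2 : ((({I : Finset (Fin n) | 2 ≤ I.card} : Finset (Finset (Fin n))).biUnion fun I =>
        {s ∈ X | ∃ z ∈ Finset.Icc 1 H, IsSquare (z * ∏ i ∈ I, s i)}).card : ℝ) ≤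
      2 ^ n * (C * (H : ℝ) ^ n * (H : ℝ) ^ (-(1 / 8) : ℝ)) := by
    calc _ ≤ ((∑ I : Finset (Fin n) with 2 ≤ I.card, ({s ∈ X | ∃ z ∈ Finset.Icc 1 H,
            IsSquare (z * ∏ i ∈ I, s i)} : Finset (Fin n → ℕ)).card : ℕ) : ℝ) :=
          Nat.cast_le.mpr Finset.card_biUnion_le
      _ ≤ ∑ I : Finset (Fin n) with 2 ≤ I.card,
            C * (H : ℝ) ^ n * (H : ℝ) ^ (-(1 / 8) : ℝ) := by
          push_cast
          exact Finset.sum_le_sum fun I hI => hC H I hH (Finset.mem_filter.mp hI).2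
      _ ≤ _ := by
          rw [Finset.sum_const, nsmul_eq_mul]
          refine mul_le_mul_of_nonneg_right ?_ (by positivity)
          have : ({I : Finset (Fin n) | 2 ≤ I.card} : Finset (Finset (Fin n))).card ≤ 2 ^ n :=
            (Finset.card_filter_le _ _).trans (by simp)
          exact_mod_cast this
  have hcard := (Finset.card_le_card hsub).trans (Finset.card_union_le _ _)
  calc ((degenerateTuples n H).card : ℝ) ≤ _ := Nat.cast_le.mpr hcard
    _ ≤ _ := by push_cast; linarith

/-! ### Counting squarefree numbers -/

open ArithmeticFunction in
lemma sum_moebius_filter_sq_dvd {H m : ℕ} (hm : 1 ≤ m) (hmH : m ≤ H) :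
    ∑ d ∈ Finset.Icc 1 (Nat.sqrt H) with d ^ 2 ∣ m, moebius d = if Squarefree m then 1 else 0 := by
  obtain ⟨a, b, ha0, hb0, hba, ha⟩ := Nat.sq_mul_squarefree_of_pos hm
  have hdvd (d : ℕ) : d ^ 2 ∣ m ↔ d ∣ b := by
    constructor
    · rintro ⟨c, hc⟩
      rcases Nat.eq_zero_or_pos d with rfl | hd
      · simp at hc; omega
      -- with `g = gcd(d, b)`, the quotient `(d / g)²` divides the squarefree number `a`
      obtain ⟨g, d', b', hg, hcop, rfl, rfl⟩ := Nat.exists_coprime' (m := d) (n := b)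
        (Nat.gcd_pos_of_pos_left _ hd)
      have h : d' ^ 2 ∣ b' ^ 2 * a := by
        refine (Nat.mul_dvd_mul_iff_left (pow_pos hg 2)).mp ⟨c, ?_⟩
        linear_combination hba + hc
      have h1 : d' ^ 2 ∣ a := (Nat.Coprime.pow 2 2 hcop).dvd_of_dvd_mul_left h
      have : d' = 1 := Nat.isUnit_iff.mp (ha d' (by rwa [← pow_two]))
      rw [this, one_mul]
      exact Dvd.intro_left _ rfl
    · intro h
      rw [← hba]
      exact (pow_dvd_pow_of_dvd h 2).mul_right a
  have hfilter : {d ∈ Finset.Icc 1 (Nat.sqrt H) | d ^ 2 ∣ m} = b.divisors := by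
    ext d
    rw [Finset.mem_filter, Finset.mem_Icc, hdvd, Nat.mem_divisors]
    constructor
    · rintro ⟨-, h⟩; exact ⟨h, hb0.ne'⟩
    · rintro ⟨h, -⟩
      refine ⟨⟨Nat.pos_of_dvd_of_pos h hb0, Nat.le_sqrt'.mpr ?_⟩, h⟩
      exact (Nat.le_of_dvd hm ((hdvd d).mpr h)).trans hmH
  rw [hfilter, ← coe_mul_zeta_apply, moebius_mul_coe_zeta, one_apply]
  have : b = 1 ↔ Squarefree m := by
    constructor
    · rintro rfl; rwa [← hba, one_pow, one_mul]
    · intro h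
      exact Nat.isUnit_iff.mp (h b ⟨a, by rw [← hba]; ring⟩)
  simp [this]

open ArithmeticFunction in
lemma card_squarefreeUpTo_eq_sum (H : ℕ) :
    ((squarefreeUpTo H).card : ℤ) =
      ∑ d ∈ Finset.Icc 1 (Nat.sqrt H), moebius d * (H / d ^ 2 : ℕ) := by
  calc ((squarefreeUpTo H).card : ℤ) =
      ∑ m ∈ Finset.Icc 1 H, if Squarefree m then (1 : ℤ) else 0 := by
        rw [squarefreeUpTo, Finset.card_filter]; push_cast; rfl
    _ = ∑ m ∈ Finset.Icc 1 H, ∑ d ∈ Finset.Icc 1 (Nat.sqrt H) with d ^ 2 ∣ m, moebius d :=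
        Finset.sum_congr rfl fun m hm => by
          rw [Finset.mem_Icc] at hm
          rw [sum_moebius_filter_sq_dvd hm.1 hm.2]
    _ = ∑ d ∈ Finset.Icc 1 (Nat.sqrt H), ∑ m ∈ Finset.Icc 1 H with d ^ 2 ∣ m, moebius d := by
        simp only [Finset.sum_filter]
        exact Finset.sum_comm
    _ = _ := Finset.sum_congr rfl fun d _ => by
        rw [Finset.sum_const, nsmul_eq_mul, mul_comm]
        congr 2
        exact Nat.Ioc_filter_dvd_card_eq_div H (d ^ 2)

/-- The sum `∑ μ(d) / d²`, which is the density of the squarefree numbers. -/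
noncomputable def squarefreeDensity : ℝ :=
  ∑' d : ℕ, (ArithmeticFunction.moebius d : ℝ) / (d : ℝ) ^ 2

lemma abs_moebius_div_sq_le (d : ℕ) :
    |(ArithmeticFunction.moebius d : ℝ) / (d : ℝ) ^ 2| ≤ ((d : ℝ) ^ 2)⁻¹ := by
  rw [abs_div, abs_of_nonneg (by positivity : (0 : ℝ) ≤ (d : ℝ) ^ 2), div_eq_mul_inv]
  refine mul_le_of_le_one_left (by positivity) ?_
  exact_mod_cast ArithmeticFunction.abs_moebius_le_one (n := d)

lemma hasSum_squarefreeDensity :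
    HasSum (fun d : ℕ => (ArithmeticFunction.moebius d : ℝ) / (d : ℝ) ^ 2) squarefreeDensity :=
  (Summable.of_norm_bounded (Real.summable_nat_pow_inv.mpr one_lt_two)
    abs_moebius_div_sq_le).hasSum

lemma ofReal_squarefreeDensity : (squarefreeDensity : ℂ) = (riemannZeta 2)⁻¹ := by
  have h2 : 1 < (2 : ℂ).re := by norm_num
  have h := ArithmeticFunction.LSeries_zeta_mul_Lseries_moebius h2
  rw [ArithmeticFunction.LSeries_zeta_eq_riemannZeta h2] at h
  rw [← eq_inv_of_mul_eq_one_right h, squarefreeDensity, Complex.ofReal_tsum, LSeries]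
  refine tsum_congr fun d => ?_
  rcases eq_or_ne d 0 with rfl | hd
  · simp
  · rw [LSeries.term_of_ne_zero hd]
    push_cast
    congr 1
    exact_mod_cast (Complex.cpow_natCast (d : ℂ) 2).symm

/-- The squarefree numbers up to `H` number `H / ζ(2) + O(√H)`. -/
lemma abs_card_squarefreeUpTo_sub_le (H : ℕ) :
    |((squarefreeUpTo H).card : ℝ) - H * squarefreeDensity| ≤ 3 * √(H : ℝ) := by
  set R := Nat.sqrt H with hR
  set f : ℕ → ℝ := fun d => (ArithmeticFunction.moebius d : ℝ) / (d : ℝ) ^ 2 with hf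
  have htail : |squarefreeDensity - ∑ d ∈ Finset.range (R + 1), f d| ≤ 2 / (R + 1) := by
    have hlim := (hasSum_squarefreeDensity.tendsto_sum_nat.sub_const
      (∑ d ∈ Finset.range (R + 1), f d)).abs
    refine le_of_tendsto hlim (eventually_atTop.mpr ⟨R + 1, fun N hN => ?_⟩)
    rw [← Finset.sum_range_add_sum_Ico _ hN, add_sub_cancel_left]
    calc |∑ d ∈ Finset.Ico (R + 1) N, f d| ≤ ∑ d ∈ Finset.Ico (R + 1) N, ((d : ℝ) ^ 2)⁻¹ :=
          (Finset.abs_sum_le_sum_abs _ _).trans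
            (Finset.sum_le_sum fun d _ => abs_moebius_div_sq_le d)
      _ ≤ 2 / (R + 1) := by
          have := sum_Ioo_inv_sq_le (α := ℝ) R N
          exact this
  have hmain : |((squarefreeUpTo H).card : ℝ) - H * ∑ d ∈ Finset.range (R + 1), f d| ≤ R := by
    have hcard : ((squarefreeUpTo H).card : ℝ) = ∑ d ∈ Finset.Icc 1 R,
        (ArithmeticFunction.moebius d : ℝ) * ((H / d ^ 2 : ℕ) : ℝ) := by
      have := congrArg (Int.cast : ℤ → ℝ) (card_squarefreeUpTo_eq_sum H)
      push_cast at this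
      exact this
    have hrange : ∑ d ∈ Finset.range (R + 1), f d = ∑ d ∈ Finset.Icc 1 R, f d := by
      rw [Finset.range_eq_Ico, Finset.sum_eq_sum_Ico_succ_bot (Nat.succ_pos R)]
      simp only [hf, Nat.cast_zero, ArithmeticFunction.map_zero, Int.cast_zero, zero_div, zero_add]
      rfl
    rw [hcard, hrange, Finset.mul_sum, ← Finset.sum_sub_distrib]
    calc _ ≤ ∑ d ∈ Finset.Icc 1 R, |(ArithmeticFunction.moebius d : ℝ) * ((H / d ^ 2 : ℕ) : ℝ) -
            H * f d| := Finset.abs_sum_le_sum_abs _ _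
      _ ≤ ∑ _d ∈ Finset.Icc 1 R, (1 : ℝ) := by
          refine Finset.sum_le_sum fun d hd => ?_
          have hd0 : 0 < d ^ 2 := pow_pos (Finset.mem_Icc.mp hd).1 2
          have hle : ((H / d ^ 2 : ℕ) : ℝ) ≤ H / (d : ℝ) ^ 2 := by
            exact_mod_cast Nat.cast_div_le (α := ℝ) (m := H) (n := d ^ 2)
          have hlt : (H : ℝ) / (d : ℝ) ^ 2 < ((H / d ^ 2 : ℕ) : ℝ) + 1 := by
            rw [div_lt_iff₀ (by exact_mod_cast hd0)]
            exact_mod_cast Nat.lt_mul_of_div_lt (Nat.lt_succ_self (H / d ^ 2)) hd0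
          have hμ : |(ArithmeticFunction.moebius d : ℝ)| ≤ 1 := by
            exact_mod_cast ArithmeticFunction.abs_moebius_le_one (n := d)
          have : (ArithmeticFunction.moebius d : ℝ) * ((H / d ^ 2 : ℕ) : ℝ) - H * f d =
              (ArithmeticFunction.moebius d : ℝ) * (((H / d ^ 2 : ℕ) : ℝ) - H / (d : ℝ) ^ 2) := by
            simp only [hf]; ring
          rw [this, abs_mul]
          refine mul_le_one₀ hμ (abs_nonneg _) ?_
          rw [abs_le]
          constructor <;> linarith
      _ = R := by simp
  have hRH : (R : ℝ) ≤ √(H : ℝ) := Real.nat_sqrt_le_real_sqrt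
  have hHR : √(H : ℝ) ≤ R + 1 := Real.real_sqrt_le_nat_sqrt_succ
  have hHtail : (H : ℝ) * (2 / (R + 1)) ≤ 2 * √(H : ℝ) := by
    rw [mul_div_assoc', div_le_iff₀ (by positivity)]
    nlinarith [Real.mul_self_sqrt (Nat.cast_nonneg (α := ℝ) H), Real.sqrt_nonneg (H : ℝ)]
  have hsplit : ((squarefreeUpTo H).card : ℝ) - H * squarefreeDensity =
      (((squarefreeUpTo H).card : ℝ) - H * ∑ d ∈ Finset.range (R + 1), f d) -
        H * (squarefreeDensity - ∑ d ∈ Finset.range (R + 1), f d) := by ring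
  rw [hsplit]
  calc _ ≤ _ := abs_sub _ _
    _ ≤ (R : ℝ) + H * (2 / (R + 1)) := by
        rw [abs_mul, Nat.abs_cast]
        exact add_le_add hmain (mul_le_mul_of_nonneg_left htail (Nat.cast_nonneg _))
    _ ≤ 3 * √(H : ℝ) := by linarith

/-! ### The asymptotic formula -/

/-- The count of fields, with a power saving in the error term. -/
lemma exists_abs_maxGaloisCount_sub_le (n : ℕ) :
    ∃ C : ℝ, 0 ≤ C ∧ ∀ H : ℕ, 1 ≤ H →
      |(maxGaloisCount n H : ℝ) - (H * squarefreeDensity) ^ n / n !| ≤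
        C * (H : ℝ) ^ n * (H : ℝ) ^ (-(1 / 8) : ℝ) := by
  obtain ⟨C, hC0, hC⟩ := exists_card_degenerateTuples_le n
  refine ⟨2 * C + 3 * n * 4 ^ (n - 1), by positivity, fun H hH => ?_⟩
  have hH1 : (1 : ℝ) ≤ H := by exact_mod_cast hH
  have hH0 : (0 : ℝ) < H := by linarith
  set Q : ℝ := ((squarefreeUpTo H).card : ℝ) with hQ
  have hQH : Q ≤ H := by rw [hQ]; exact_mod_cast card_squarefreeUpTo_le H
  have hQ0 : 0 ≤ Q := Nat.cast_nonneg _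
  have hdens := abs_card_squarefreeUpTo_sub_le H
  have hsqrtH : √(H : ℝ) ≤ H := Real.sqrt_le_iff.mpr ⟨hH0.le, by nlinarith⟩
  have hpow : |Q ^ n - (H * squarefreeDensity) ^ n| ≤
      3 * n * 4 ^ (n - 1) * (H : ℝ) ^ n * (H : ℝ) ^ (-(1 / 8) : ℝ) := by
    rcases Nat.eq_zero_or_pos n with rfl | hn
    · simp
    have hmax : max |Q| |H * squarefreeDensity| ≤ 4 * H := by
      rw [abs_le] at hdens
      refine max_le ?_ ?_ <;> rw [abs_le] <;> constructor <;> linarith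
    calc |Q ^ n - (H * squarefreeDensity) ^ n| ≤
        |Q - H * squarefreeDensity| * n * max |Q| |H * squarefreeDensity| ^ (n - 1) :=
          abs_pow_sub_pow_le _ _ _
      _ ≤ 3 * √(H : ℝ) * n * (4 * H) ^ (n - 1) := by gcongr
      _ = 3 * n * 4 ^ (n - 1) * (√(H : ℝ) * (H : ℝ) ^ (n - 1)) := by rw [mul_pow]; ring
      _ ≤ 3 * n * 4 ^ (n - 1) * ((H : ℝ) ^ n * (H : ℝ) ^ (-(1 / 8) : ℝ)) := by
          refine mul_le_mul_of_nonneg_left ?_ (by positivity)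
          rw [Real.sqrt_eq_rpow, ← Real.rpow_natCast, ← Real.rpow_natCast, ← Real.rpow_add hH0,
            ← Real.rpow_add hH0, Nat.cast_sub hn]
          refine Real.rpow_le_rpow_of_exponent_le hH1 ?_
          push_cast
          linarith
      _ = _ := by ring
  have hfac : (1 : ℝ) ≤ n ! := by exact_mod_cast n.factorial_pos
  have hpow' : |Q ^ n / (n ! : ℝ) - (H * squarefreeDensity) ^ n / n !| ≤
      3 * n * 4 ^ (n - 1) * (H : ℝ) ^ n * (H : ℝ) ^ (-(1 / 8) : ℝ) := by
    rw [← sub_div, abs_div, Nat.abs_cast]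
    exact (div_le_self (abs_nonneg _) hfac).trans hpow
  have h1 := abs_maxGaloisCount_sub_le n H
  have h2 := hC H hH
  calc _ ≤ _ := abs_sub_le _ (Q ^ n / n !) _
    _ ≤ 2 * (C * (H : ℝ) ^ n * (H : ℝ) ^ (-(1 / 8) : ℝ)) +
        3 * n * 4 ^ (n - 1) * (H : ℝ) ^ n * (H : ℝ) ^ (-(1 / 8) : ℝ) :=
      add_le_add (h1.trans (by linarith)) hpow'
    _ = _ := by ring

lemma eventually_rpow_neg_le_exp :
    ∀ᶠ H : ℕ in atTop, (H : ℝ) ^ (-(1 / 8) : ℝ) ≤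
      Real.exp (-√(Real.log H * Real.log (Real.log H) / 2)) := by
  have hlog : Tendsto (fun H : ℕ => Real.log H) atTop atTop :=
    Real.tendsto_log_atTop.comp tendsto_natCast_atTop_atTop
  have hle : ∀ᶠ x : ℝ in atTop, ‖Real.log x‖ ≤ (1 / 32) * ‖x‖ :=
    Real.isLittleO_log_id_atTop.def (by norm_num)
  filter_upwards [hlog.eventually hle, hlog.eventually_ge_atTop 0, eventually_ge_atTop 1]
    with H h hL hH
  have hH0 : (0 : ℝ) < H := by exact_mod_cast hH
  rw [Real.rpow_def_of_pos hH0, Real.exp_le_exp]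
  have hll : Real.log (Real.log H) ≤ 1 / 32 * Real.log H := by
    rw [Real.norm_eq_abs, Real.norm_eq_abs, abs_of_nonneg hL] at h
    exact (le_abs_self _).trans h
  have : √(Real.log H * Real.log (Real.log H) / 2) ≤ Real.log H / 8 := by
    refine Real.sqrt_le_iff.mpr ⟨by positivity, ?_⟩
    nlinarith
  linarith

theorem theorem3p3 (n : ℕ) (hn : 1 ≤ n) :
    ∃ ε : ℕ → ℝ, Tendsto ε atTop (𝓝 0) ∧
      (fun H : ℕ => (maxGaloisCount n H : ℂ) -
          1 / ((n ! : ℂ) * riemannZeta 2 ^ n) * (H : ℂ) ^ n)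
        =O[atTop] (fun H : ℕ =>
          Real.exp (-(1 + ε H) * √(Real.log H * Real.log (Real.log H) / 2)) * (H : ℝ) ^ n) := by
  -- the error term is smaller by a power of `H`, so no correction `ε` is needed
  refine ⟨fun _ => 0, tendsto_const_nhds, ?_⟩
  obtain ⟨C, hC0, hC⟩ := exists_abs_maxGaloisCount_sub_le n
  refine IsBigO.of_bound C ?_
  filter_upwards [eventually_rpow_neg_le_exp, eventually_ge_atTop 1] with H hexp hH
  have hcast : (maxGaloisCount n H : ℂ) - 1 / ((n ! : ℂ) * riemannZeta 2 ^ n) * (H : ℂ) ^ n =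
      (((maxGaloisCount n H : ℝ) - (H * squarefreeDensity) ^ n / n ! : ℝ) : ℂ) := by
    push_cast
    rw [ofReal_squarefreeDensity, mul_pow, inv_pow, one_div, mul_inv]
    ring
  rw [hcast, Complex.norm_real, Real.norm_eq_abs, add_zero, neg_one_mul]
  refine le_trans ?_ (mul_le_mul_of_nonneg_left (Real.le_norm_self _) hC0)
  calc _ ≤ C * (H : ℝ) ^ n * (H : ℝ) ^ (-(1 / 8) : ℝ) := hC H hH
    _ ≤ C * (H : ℝ) ^ n * Real.exp (-√(Real.log H * Real.log (Real.log H) / 2)) :=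
        mul_le_mul_of_nonneg_left hexp (by positivity)
    _ = _ := by ring
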